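/- Let $\mathbb K\in\{\mathbb R,\mathbb C\}$, let $r\ge 1$ and $k\ge 0$ be integers, and let $T$ be an $n$-simplex ($n\ge 0$) with ordered vertices $v_0,\dots,v_n$. A subsimplex $F\subseteq T$ is the simplex spanned by a nonempty set of vertices of $T$, ordered as in $T$. *Spaces.* For an $m$-simplex $F$ with barycentric coordinates $\lambda^F_0,\dots,\lambda^F_m$, let $\mathcal P_r\Lambda^k(F)$ be the $\mathbb K$-linear hull of the forms $\lambda_F^\alpha\, d\lambda^F_\sigma=\prod_i(\lambda^F_i)^{\alpha(i)}\,d\lambda^F_{\sigma(1)}\wedge\dots\wedge d\lambda^F_{\sigma(k)}$ with multiindices $\alpha$ on $\{0,\dots,m\}$, $|\alpha|=r$, and strictly increasing $\sigma:\{1,\dots,k\}\to\{0,\dots,m\}$. Let $\mathring{\mathcal P}_r\Lambda^k(F)$ be the linear hull of those with, in addition, $\{i:\alpha(i)>0\}\cup\sigma(\{1,\dots,k\})=\{0,\dots,m\}$. *Extension.* Let $F\subseteq T$ be a subsimplex, and let $\imath$ be the increasing map that sends the index of a vertex in $F$ to its index in $T$. The operator $\operatorname{ext}_{F,T}:\mathring{\mathcal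 P}_r\Lambda^k(F)\to\mathcal P_r\Lambda^k(T)$ is the restriction of the unique linear map on $\mathcal P_r\Lambda^k(F)$ with $$\lambda_F^\alpha\,d\lambda^F_\sigma\longmapsto\lambda_T^{\tilde\alpha}\,\Psi_{\imath\sigma(1)}\wedge\dots\wedge\Psi_{\imath\sigma(k)},\qquad \Psi_i=d\lambda^T_i-\frac{\tilde\alpha_i}{|\tilde\alpha|}\sum_{j\in[\imath]}d\lambda^T_j ,$$ for all $\alpha$, $\sigma$ as above, where $\tilde\alpha$ is the extension of $\alpha$ by zero (so $\tilde\alpha\circ\imath=\alpha$) and $[\imath]$ is the image of $\imath$. *Symmetries.* For a permutation $\pi$ of $\{0,\dots,n\}$ let $S_\pi$ be the affine automorphism of $T$ with $S_\pi(v_i)=v_{\pi^{-1}(i)}$. It restricts to affine diffeomorphisms $F\to S_\pi F$ for all subsimplices $F\subseteq T$; $S_\pi^*$ denotes the pullback of forms along $S_\pi$ on $T$ and along these restrictions. The symmetries of each $F$ are defined in the same way from the permutations of its own vertices. A finite set $\mathcal Q$ of forms on a simplex is *$\mathbb K$-invariant* if the pullback along each symmetry of that simplex permutes the members of $\mathcal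 Q$ up to multiplication by nonzero elements of $\mathbb K$. **Theorem.** For each subsimplex $F\subseteq T$ let $\mathcal Q(F)$ be a $\mathbb K$-invariant basis of $\mathring{\mathcal P}_r\Lambda^k(F)$. Suppose that for all permutations $\pi$ of $\{0,\dots,n\}$ and all subsimplices $F\subseteq T$ the sets $S_\pi^*\mathcal Q(S_\pi F)$ and $\mathcal Q(F)$ agree up to multiplication of their members by nonzero scalars in $\mathbb K$ (for instance, $S_\pi^*\mathcal Q(S_\pi F)=\mathcal Q(F)$). Then $$\bigcup_{F\subseteq T}\operatorname{ext}_{F,T}\,\mathcal Q(F)$$ is a $\mathbb K$-invariant basis of $\mathcal P_r\Lambda^k(T)$. -/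

import Mathlib

noncomputable section

namespace SimplexForms

open Finset

section Simplices

variable {V P : Type*} [AddCommGroup V] [Module ℝ V] [AddTorsor V P] {n m : ℕ}

/-- The affine span of a simplex `T`. -/
abbrev Carrier (T : Affine.Simplex ℝ P n) : AffineSubspace ℝ P :=
  affineSpan ℝ (Set.range T.points)

/-- The tangent space of a simplex `T`: the direction of its affine span. -/
abbrev Tangent (T : Affine.Simplex ℝ P n) : Submodule ℝ V :=
  (Carrier T).direction

/-- The vertices of `T`, as an affine basis of its affine span. -/
def vertexBasis (T : Affine.Simplex ℝ P n) : AffineBasis (Fin (n + 1)) ℝ (Carrier T) where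
  toFun i := ⟨T.points i, mem_affineSpan ℝ (Set.mem_range_self i)⟩
  ind' := (T.restrict (Carrier T) le_rfl).independent
  tot' := by
    have h := affineSpan_coe_preimage_eq_top (k := ℝ) (Set.range T.points)
    rw [← h]
    congr 1
    ext x
    simp [Subtype.ext_iff, eq_comm]

@[simp]
theorem coe_vertexBasis (T : Affine.Simplex ℝ P n) (i : Fin (n + 1)) :
    ((vertexBasis T i : Carrier T) : P) = T.points i := rfl

/-- A point of the closed simplex `T` (the convex hull of its vertices), as a point of the affine
span of `T`. -/
def toCarrier {T : Affine.Simplex ℝ P n} (x : T.closedInterior) : Carrier T :=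
  ⟨x, T.closedInterior_subset_affineSpan x.2⟩

/-- The `i`-th barycentric coordinate `λ_i` of `T`: the unique affine function on the affine span
of `T` that is `1` at the vertex `i` and `0` at the other vertices. -/
def bary (T : Affine.Simplex ℝ P n) (i : Fin (n + 1)) : Carrier T →ᵃ[ℝ] ℝ :=
  (vertexBasis T).coord i

/-- The exterior derivative `dλ_i` of the affine function `λ_i`: its constant differential. -/
def dbary (T : Affine.Simplex ℝ P n) (i : Fin (n + 1)) : Module.Dual ℝ (Tangent T) :=
  (bary T i).linear

/-- A point of the affine span of `T` lies in the closed simplex as soon as its barycentric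
coordinates are nonnegative. -/
theorem mem_closedInterior_of_nonneg (T : Affine.Simplex ℝ P n) (x : Carrier T)
    (hx : ∀ i, 0 ≤ bary T i x) : (x : P) ∈ T.closedInterior := by
  have hsum : ∑ i, bary T i x = 1 := (vertexBasis T).sum_coord_apply_eq_one x
  refine ⟨fun i => bary T i x, hsum, fun i => ⟨hx i, ?_⟩, ?_⟩
  · rw [← hsum]
    exact Finset.single_le_sum (f := fun j => bary T j x) (fun j _ => hx j) (Finset.mem_univ i)
  · have h := (vertexBasis T).affineCombination_coord_eq_self x
    have h2 := Finset.map_affineCombination Finset.univ (vertexBasis T) _ hsum (Carrier T).subtype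
    exact h2.symm.trans (congrArg (Carrier T).subtype h)

theorem bary_nonneg {T : Affine.Simplex ℝ P n} (x : T.closedInterior) (i : Fin (n + 1)) :
    0 ≤ bary T i (toCarrier x) := by
  obtain ⟨x, w, hw, hI, rfl⟩ := x
  have h : toCarrier (T := T) ⟨_, w, hw, hI, rfl⟩
      = Finset.univ.affineCombination ℝ (vertexBasis T) w := by
    apply Subtype.ext
    have h2 := Finset.map_affineCombination Finset.univ (vertexBasis T) w hw (Carrier T).subtype
    exact h2.symm
  rw [h, bary, (vertexBasis T).coord_apply_combination_of_mem (Finset.mem_univ i) hw]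
  exact (hI i).1

/-- The unique affine map between the affine spans of two simplices that takes the vertex `v_i` of
`T` to the vertex `v'_{f i}` of `T'`. -/
def simplexMap (T : Affine.Simplex ℝ P n) (T' : Affine.Simplex ℝ P m)
    (f : Fin (n + 1) → Fin (m + 1)) : Carrier T →ᵃ[ℝ] Carrier T' :=
  (Finset.univ.affineCombination ℝ (fun i => vertexBasis T' (f i))).comp (vertexBasis T).coords

theorem simplexMap_vertex (T : Affine.Simplex ℝ P n) (T' : Affine.Simplex ℝ P m)
    (f : Fin (n + 1) → Fin (m + 1)) (i : Fin (n + 1)) :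
    simplexMap T T' f (vertexBasis T i) = vertexBasis T' (f i) := by
  have h : (vertexBasis T).coords (vertexBasis T i) = Pi.single i 1 := by
    ext j
    simp [AffineBasis.coord_apply, Pi.single_apply]
  rw [simplexMap, AffineMap.comp_apply, h]
  exact Finset.univ.affineCombination_piSingle ℝ _ (Finset.mem_univ i)

theorem simplexMap_mem (T : Affine.Simplex ℝ P n) (T' : Affine.Simplex ℝ P m)
    (f : Fin (n + 1) → Fin (m + 1)) (x : T.closedInterior) :
    (simplexMap T T' f (toCarrier x) : P) ∈ T'.closedInterior := by
  apply mem_closedInterior_of_nonneg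
  intro j
  have hsum : ∑ i, (vertexBasis T).coords (toCarrier x) i = 1 :=
    (vertexBasis T).sum_coord_apply_eq_one _
  rw [simplexMap, AffineMap.comp_apply, Finset.map_affineCombination _ _ _ hsum,
    Finset.affineCombination_eq_linear_combination _ _ _ hsum]
  refine Finset.sum_nonneg fun i _ => mul_nonneg (bary_nonneg x i) ?_
  simp only [Function.comp, bary, AffineBasis.coord_apply]
  split_ifs <;> norm_num

/-- The map between closed simplices obtained by restricting `simplexMap`. -/
def simplexMapOn (T : Affine.Simplex ℝ P n) (T' : Affine.Simplex ℝ P m)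
    (f : Fin (n + 1) → Fin (m + 1)) (x : T.closedInterior) : T'.closedInterior :=
  ⟨simplexMap T T' f (toCarrier x), simplexMap_mem T T' f x⟩

/-- A subsimplex of an `n`-simplex is given by its nonempty set of vertices. -/
abbrev Subsimplex (n : ℕ) := {s : Finset (Fin (n + 1)) // s.Nonempty}

namespace Subsimplex

/-- The dimension of a subsimplex. -/
def dim (F : Subsimplex n) : ℕ := #F.1 - 1

theorem card_eq (F : Subsimplex n) : #F.1 = F.dim + 1 :=
  (Nat.succ_pred_eq_of_pos F.2.card_pos).symm

/-- The increasing enumeration `ι(F,T)` of the vertices of the subsimplex `F`. -/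
def incl (F : Subsimplex n) : Fin (F.dim + 1) ↪o Fin (n + 1) := F.1.orderEmbOfFin F.card_eq

/-- The subsimplex `S_π F`. As `S_π` takes the vertex `v_i` to `v_{π⁻¹ i}`, its set of vertices is
the image of that of `F` under `π⁻¹`. -/
def move (π : Equiv.Perm (Fin (n + 1))) (F : Subsimplex n) : Subsimplex n :=
  ⟨F.1.map π.symm.toEmbedding, F.2.map⟩

/-- The map on vertex numbers induced by `S_π : F → S_π F`. -/
def moveIdx (π : Equiv.Perm (Fin (n + 1))) (F : Subsimplex n) (i : Fin (F.dim + 1)) :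
    Fin ((F.move π).dim + 1) :=
  ((F.move π).1.orderIsoOfFin (F.move π).card_eq).symm
    ⟨π.symm (F.incl i), Finset.mem_map_of_mem _ (F.1.orderEmbOfFin_mem F.card_eq i)⟩

theorem incl_moveIdx (π : Equiv.Perm (Fin (n + 1))) (F : Subsimplex n) (i : Fin (F.dim + 1)) :
    (F.move π).incl (moveIdx π F i) = π.symm (F.incl i) := by
  rw [incl, ← Finset.coe_orderIsoOfFin_apply, moveIdx, OrderIso.apply_symm_apply]

end Subsimplex

/-- The subsimplex of `T` with vertex set `F`, its vertices ordered as in `T`. -/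
abbrev subsimplex (T : Affine.Simplex ℝ P n) (F : Subsimplex n) : Affine.Simplex ℝ P F.dim :=
  T.face F.card_eq

/-- The affine map `F → S_π F` sending vertices to vertices as `S_π` does is the restriction to `F`
of the simplicial symmetry `S_π` of `T`. -/
theorem simplexMap_moveIdx (T : Affine.Simplex ℝ P n) (π : Equiv.Perm (Fin (n + 1))) (F : Subsimplex n)
    (x : Carrier (subsimplex T F)) (hx : (x : P) ∈ Carrier T) :
    (simplexMap (subsimplex T F) (subsimplex T (F.move π)) (F.moveIdx π) x : P)
      = simplexMap T T π.symm ⟨x, hx⟩ := by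
  have hle : Carrier (subsimplex T F) ≤ Carrier T := by
    apply affineSpan_mono
    rintro _ ⟨i, rfl⟩
    exact ⟨F.incl i, rfl⟩
  have h : (Carrier (subsimplex T (F.move π))).subtype.comp
        (simplexMap (subsimplex T F) (subsimplex T (F.move π)) (F.moveIdx π))
      = ((Carrier T).subtype.comp (simplexMap T T π.symm)).comp
        (AffineSubspace.inclusion hle) := by
    apply AffineMap.ext_on (s := Set.range (vertexBasis (subsimplex T F)))
    · exact (vertexBasis (subsimplex T F)).tot
    · rintro _ ⟨i, rfl⟩
      have h1 : AffineSubspace.inclusion hle (vertexBasis (subsimplex T F) i)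
          = vertexBasis T (F.incl i) := rfl
      simp only [AffineMap.comp_apply]
      erw [h1]
      rw [simplexMap_vertex, simplexMap_vertex]
      change T.points ((F.move π).incl (F.moveIdx π i)) = T.points (π.symm (F.incl i))
      rw [Subsimplex.incl_moveIdx]
  exact DFunLike.congr_fun h x

end Simplices

section Forms

variable (𝕂 : Type*) [RCLike 𝕂]
variable {V P : Type*} [AddCommGroup V] [Module ℝ V] [AddTorsor V P] {n m : ℕ}

/-- Fields of `𝕂`-valued alternating `k`-covectors over the closed simplex `T`. For `𝕂 = ℝ` this
contains the differential `k`-forms on `T`, for `𝕂 = ℂ` their complexification. -/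
abbrev Form (T : Affine.Simplex ℝ P n) (k : ℕ) : Type _ :=
  T.closedInterior → (Tangent T) [⋀^Fin k]→ₗ[ℝ] 𝕂

/-- The exterior product `f_1 ∧ ⋯ ∧ f_k` of linear functionals,
`(w_1, …, w_k) ↦ det (f_j (w_i))`, regarded as a `𝕂`-valued form; for `k = 0` it is `1`. -/
def wedge {W : Type*} [AddCommGroup W] [Module ℝ W] {k : ℕ} (f : Fin k → Module.Dual ℝ W) :
    W [⋀^Fin k]→ₗ[ℝ] 𝕂 :=
  (Algebra.linearMap ℝ 𝕂).compAlternatingMap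
    ((Matrix.detRowAlternating (n := Fin k) (R := ℝ)).compLinearMap (LinearMap.pi f))

/-- The barycentric monomial `λ_T^α`, as a function on the closed simplex. -/
def baryMonomial (T : Affine.Simplex ℝ P n) (α : Fin (n + 1) → ℕ) (x : T.closedInterior) : ℝ :=
  ∏ i, bary T i (toCarrier x) ^ α i

/-- The form `λ_T^α f_1 ∧ ⋯ ∧ f_k`, where the `f_j` are constant one-forms on `T`. -/
def polyForm (T : Affine.Simplex ℝ P n) {k : ℕ} (α : Fin (n + 1) → ℕ)
    (f : Fin k → Module.Dual ℝ (Tangent T)) : Form 𝕂 T k :=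
  fun x => (baryMonomial T α x : 𝕂) • wedge 𝕂 f

/-- The space `𝒫_rΛ^k(T)`: the linear hull of the forms
`λ_T^α dλ_{σ(1)} ∧ ⋯ ∧ dλ_{σ(k)}` with `|α| = r` and `σ` strictly increasing. -/
def polySpace (T : Affine.Simplex ℝ P n) (r k : ℕ) : Submodule 𝕂 (Form 𝕂 T k) :=
  Submodule.span 𝕂 {ω | ∃ (α : Fin (n + 1) → ℕ) (σ : Fin k ↪o Fin (n + 1)),
    ∑ i, α i = r ∧ ω = polyForm 𝕂 T α (fun j => dbary T (σ j))}

/-- The space `𝒫̊_rΛ^k(T)`: the linear hull of the forms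
`λ_T^α dλ_{σ(1)} ∧ ⋯ ∧ dλ_{σ(k)}` with `|α| = r`, `σ` strictly increasing and
`[α] ∪ [σ] = {0, …, n}`. -/
def polySpace₀ (T : Affine.Simplex ℝ P n) (r k : ℕ) : Submodule 𝕂 (Form 𝕂 T k) :=
  Submodule.span 𝕂 {ω | ∃ (α : Fin (n + 1) → ℕ) (σ : Fin k ↪o Fin (n + 1)),
    ∑ i, α i = r ∧ (∀ i, 0 < α i ∨ i ∈ Set.range σ) ∧
      ω = polyForm 𝕂 T α (fun j => dbary T (σ j))}

theorem polySpace₀_le (T : Affine.Simplex ℝ P n) (r k : ℕ) :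
    polySpace₀ 𝕂 T r k ≤ polySpace 𝕂 T r k :=
  Submodule.span_mono fun _ ⟨α, σ, hα, _, h⟩ => ⟨α, σ, hα, h⟩

/-- The pullback of forms along the affine map `T → T'` determined by the map `f` of vertices. -/
def pullback (T : Affine.Simplex ℝ P n) (T' : Affine.Simplex ℝ P m)
    (f : Fin (n + 1) → Fin (m + 1)) (k : ℕ) : Form 𝕂 T' k →ₗ[𝕂] Form 𝕂 T k where
  toFun ω x := (ω (simplexMapOn T T' f x)).compLinearMap (simplexMap T T' f).linear
  map_add' _ _ := rfl
  map_smul' _ _ := rfl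

/-- The pullback `S_π^*` along the simplicial symmetry of `T` with `S_π(v_i) = v_{π⁻¹(i)}`. -/
def symmPullback (T : Affine.Simplex ℝ P n) (k : ℕ) (π : Equiv.Perm (Fin (n + 1))) :
    Form 𝕂 T k →ₗ[𝕂] Form 𝕂 T k :=
  pullback 𝕂 T T π.symm k

/-- The pullback `S_π^*` of forms over `S_π F` to forms over `F`, along the restriction of `S_π`
to an affine diffeomorphism `F → S_π F`. -/
def subPullback (T : Affine.Simplex ℝ P n) (k : ℕ) (π : Equiv.Perm (Fin (n + 1))) (F : Subsimplex n) :
    Form 𝕂 (subsimplex T (F.move π)) k →ₗ[𝕂] Form 𝕂 (subsimplex T F) k :=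
  pullback 𝕂 (subsimplex T F) (subsimplex T (F.move π)) (F.moveIdx π) k

/-- The extension `α̃` by zero of a multiindex on the vertices of `F`. -/
def extIdx (F : Subsimplex n) (α : Fin (F.dim + 1) → ℕ) : Fin (n + 1) → ℕ :=
  Function.extend F.incl α 0

/-- The one-form `Ψ_i^{α,F,T} = dλ_i - (α_i / |α|) ∑_{j ∈ F} dλ_j` on `T`. -/
def Psi (T : Affine.Simplex ℝ P n) (F : Subsimplex n) (α : Fin (n + 1) → ℕ) (i : Fin (n + 1)) :
    Module.Dual ℝ (Tangent T) :=
  dbary T i - ((α i : ℝ) / ((∑ j, α j : ℕ) : ℝ)) • ∑ j ∈ F.1, dbary T j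

theorem sum_alt_apply {A ι : Type*} [AddCommGroup A] [Module ℝ A] {k : ℕ} (s : Finset ι)
    (c : ι → A [⋀^Fin k]→ₗ[ℝ] 𝕂) (w : Fin k → A) : (∑ i ∈ s, c i) w = ∑ i ∈ s, c i w :=
  map_sum (AddMonoidHom.mk' (fun d : A [⋀^Fin k]→ₗ[ℝ] 𝕂 => d w) fun _ _ => rfl) c s

/-- The form `λ_T^α̃ Ψ_{σ̃(1)} ∧ ⋯ ∧ Ψ_{σ̃(k)}` with `Ψ_i = Ψ_i^{α̃,F,T}`, which is the extension
of `λ_F^α dλ_{σ(1)} ∧ ⋯ ∧ dλ_{σ(k)}`. -/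
def extForm (T : Affine.Simplex ℝ P n) (F : Subsimplex n) {k : ℕ} (α : Fin (F.dim + 1) → ℕ)
    (σ : Fin k ↪o Fin (F.dim + 1)) : Form 𝕂 T k :=
  polyForm 𝕂 T (extIdx F α) (fun j => Psi T F (extIdx F α) (F.incl (σ j)))

theorem wedge_compLinearMap {W W' : Type*} [AddCommGroup W] [Module ℝ W] [AddCommGroup W']
    [Module ℝ W'] {k : ℕ} (f : Fin k → Module.Dual ℝ W) (L : W' →ₗ[ℝ] W) :
    (wedge 𝕂 f).compLinearMap L = wedge 𝕂 (fun j => (f j).comp L) := by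
  ext w
  rfl

theorem extIdx_incl (F : Subsimplex n) (α : Fin (F.dim + 1) → ℕ) (i : Fin (F.dim + 1)) :
    extIdx F α (F.incl i) = α i :=
  F.incl.injective.extend_apply α 0 i

theorem sum_incl {M : Type*} [AddCommMonoid M] (F : Subsimplex n) (g : Fin (n + 1) → M) :
    ∑ j ∈ F.1, g j = ∑ i, g (F.incl i) := by
  conv_lhs => rw [← Finset.map_orderEmbOfFin_univ F.1 F.card_eq]
  rw [Finset.sum_map]
  rfl

theorem sum_extIdx (F : Subsimplex n) (α : Fin (F.dim + 1) → ℕ) :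
    ∑ j, extIdx F α j = ∑ i, α i := by
  rw [← Finset.sum_subset (Finset.subset_univ F.1), sum_incl]
  · simp [extIdx_incl]
  · intro j _ hj
    refine Function.extend_apply' _ _ _ ?_
    rintro ⟨i, rfl⟩
    exact hj (F.1.orderEmbOfFin_mem F.card_eq i)

theorem sum_Psi (T : Affine.Simplex ℝ P n) (F : Subsimplex n) (α : Fin (F.dim + 1) → ℕ)
    (hα : 0 < ∑ i, α i) : ∑ i, Psi T F (extIdx F α) (F.incl i) = 0 := by
  have h : (∑ i, (α i : ℝ)) ≠ 0 := by exact_mod_cast hα.ne'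
  simp only [Psi, Finset.sum_sub_distrib, ← Finset.sum_smul, sum_extIdx, extIdx_incl,
    ← Finset.sum_div]
  push_cast
  rw [div_self h, one_smul, sum_incl, sub_self]

theorem dbary_vsub (T : Affine.Simplex ℝ P n) (i j l : Fin (n + 1)) :
    dbary T i (vertexBasis T j -ᵥ vertexBasis T l)
      = (if i = j then 1 else 0) - (if i = l then 1 else 0) := by
  rw [dbary, AffineMap.linearMap_vsub, bary, AffineBasis.coord_apply, AffineBasis.coord_apply]
  rfl

/-- There is a linear map between tangent spaces along which the `dλ_i^F` pull back
to the `Ψ_i^{α̃,F,T}`. -/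
theorem exists_dbary_comp (T : Affine.Simplex ℝ P n) (F : Subsimplex n) (α : Fin (F.dim + 1) → ℕ)
    (hα : 0 < ∑ i, α i) : ∃ L : Tangent T →ₗ[ℝ] Tangent (subsimplex T F),
      ∀ i, (dbary (subsimplex T F) i).comp L = Psi T F (extIdx F α) (F.incl i) := by
  refine ⟨∑ j, (Psi T F (extIdx F α) (F.incl j)).smulRight
    (vertexBasis (subsimplex T F) j -ᵥ vertexBasis (subsimplex T F) 0), fun i => ?_⟩
  ext w
  have h := LinearMap.congr_fun (sum_Psi T F α hα) w
  rw [LinearMap.sum_apply, LinearMap.zero_apply] at h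
  simp only [LinearMap.comp_apply, LinearMap.sum_apply, map_sum, LinearMap.smulRight_apply,
    map_smul, dbary_vsub, smul_eq_mul, mul_sub, Finset.sum_sub_distrib, ← Finset.sum_mul, h]
  simp

/-- The barycentric monomials of degree `r` are linearly independent on the simplex. -/
theorem monomial_indep {A : Type*} [AddCommGroup A] [Module ℝ A] {k : ℕ}
    (T : Affine.Simplex ℝ P n) (r : ℕ) (c : (Fin (n + 1) → ℕ) → A [⋀^Fin k]→ₗ[ℝ] 𝕂)
    (hc : ∀ x : T.closedInterior,
      ∑ α ∈ Finset.piAntidiag univ r, (baryMonomial T α x : 𝕂) • c α = 0)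
    (α : Fin (n + 1) → ℕ) (hα : ∑ i, α i = r) : c α = 0 := by
  ext w
  let p : MvPolynomial (Fin (n + 1)) 𝕂 := ∑ β ∈ Finset.piAntidiag univ r,
    MvPolynomial.monomial (Finsupp.equivFunOnFinite.symm β) (c β w)
  have hp : p = 0 := by
    refine MvPolynomial.funext_set (fun _ => (fun t : ℝ => (t : 𝕂)) '' Set.Ioi 0) (fun _ => ?_) ?_
    · exact (Set.Ioi_infinite (0 : ℝ)).image (RCLike.ofReal_injective.injOn)
    · intro y hy
      choose t ht hty using fun i => hy i (Set.mem_univ i)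
      have hs : 0 < ∑ i, t i :=
        Finset.sum_pos (fun i _ => ht i) ⟨0, Finset.mem_univ _⟩
      set s := ∑ i, t i
      have hsum : ∑ i, t i / s = 1 := by rw [← Finset.sum_div, div_self hs.ne']
      let q : Carrier T := Finset.univ.affineCombination ℝ (vertexBasis T) (fun i => t i / s)
      have hq : ∀ i, bary T i q = t i / s := fun i =>
        (vertexBasis T).coord_apply_combination_of_mem (Finset.mem_univ i) hsum
      let x : T.closedInterior := ⟨q, mem_closedInterior_of_nonneg T q fun i => by
        rw [hq]; exact (div_pos (ht i) hs).le⟩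
      have hx : ∀ i, bary T i (toCarrier x) = t i / s := hq
      have h := DFunLike.congr_fun (hc x) w
      simp only [p, map_sum, map_zero, MvPolynomial.eval_monomial]
      have h2 : ((s : 𝕂) ^ r) * (∑ β ∈ Finset.piAntidiag univ r,
          (baryMonomial T β x : 𝕂) • c β) w = 0 := by rw [h]; simp
      rw [← h2, sum_alt_apply, Finset.mul_sum]
      refine Finset.sum_congr rfl fun β hβ => ?_
      have hβr : ∑ i, β i = r := (Finset.mem_piAntidiag.1 hβ).1
      have hm : baryMonomial T β x * s ^ r = ∏ i, t i ^ β i := by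
        simp only [baryMonomial, hx, div_pow, Finset.prod_div_distrib, Finset.prod_pow_eq_pow_sum, hβr]
        exact div_mul_cancel₀ _ (pow_pos hs r).ne'
      rw [AlternatingMap.smul_apply, smul_eq_mul, ← mul_assoc, mul_comm ((s : 𝕂) ^ r),
        ← RCLike.ofReal_pow, ← RCLike.ofReal_mul, hm, mul_comm]
      congr 1
      simp [← hty, Finsupp.prod_fintype]
  have h := congrArg (MvPolynomial.coeff (Finsupp.equivFunOnFinite.symm α)) hp
  simp only [p, MvPolynomial.coeff_sum, MvPolynomial.coeff_monomial, MvPolynomial.coeff_zero,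
    EmbeddingLike.apply_eq_iff_eq] at h
  rw [Finset.sum_ite_eq' ] at h
  rw [if_pos (by simp [Finset.mem_piAntidiag, hα])] at h
  simpa using h

/-- The formula for the extension of the generators `λ_F^α dλ_σ` of `𝒫_rΛ^k(F)` determines a
unique linear map. -/
theorem existsUnique_ext (T : Affine.Simplex ℝ P n) (F : Subsimplex n) {r : ℕ} (hr : 0 < r) (k : ℕ) :
    ∃! E : polySpace 𝕂 (subsimplex T F) r k →ₗ[𝕂] Form 𝕂 T k,
      ∀ (α : Fin (F.dim + 1) → ℕ) (σ : Fin k ↪o Fin (F.dim + 1)) (hα : ∑ i, α i = r),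
        E ⟨polyForm 𝕂 (subsimplex T F) α (fun j => dbary (subsimplex T F) (σ j)),
          Submodule.subset_span ⟨α, σ, hα, rfl⟩⟩ = extForm 𝕂 T F α σ := by
  refine existsUnique_of_exists_of_unique ?_ ?_
  · let S : Finset (Fin (F.dim + 1) → ℕ) := Finset.piAntidiag univ r
    have hI : ∀ α : S, ∑ i, α.1 i = r := fun α => (Finset.mem_piAntidiag.1 α.2).1
    choose L hL using fun α : S => exists_dbary_comp T F α.1 ((hI α).symm ▸ hr)
    let A : (S → (Tangent (subsimplex T F)) [⋀^Fin k]→ₗ[ℝ] 𝕂) →ₗ[𝕂] Form 𝕂 (subsimplex T F) k :=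
      { toFun := fun c x => ∑ α, (baryMonomial (subsimplex T F) α.1 x : 𝕂) • c α
        map_add' := fun c d => by
          funext x
          simp [Finset.sum_add_distrib]
        map_smul' := fun a c => by
          funext x
          simp [Finset.smul_sum, smul_comm a] }
    let B : (S → (Tangent (subsimplex T F)) [⋀^Fin k]→ₗ[ℝ] 𝕂) →ₗ[𝕂] Form 𝕂 T k :=
      { toFun := fun c x =>
          ∑ α, (baryMonomial T (extIdx F α.1) x : 𝕂) • (c α).compLinearMap (L α)
        map_add' := fun c d => by
          funext x
          simp [Finset.sum_add_distrib, AlternatingMap.add_compLinearMap]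
        map_smul' := fun a c => by
          funext x
          ext w
          simp [sum_alt_apply, Finset.mul_sum, mul_left_comm a] }
    have hA : LinearMap.ker A = ⊥ := by
      rw [LinearMap.ker_eq_bot']
      intro c hc
      funext α
      have := monomial_indep 𝕂 (subsimplex T F) r
        (fun β => if h : β ∈ S then c ⟨β, h⟩ else 0) (fun x => by
          rw [← Finset.sum_coe_sort]
          refine Eq.trans ?_ (congrFun hc x)
          exact Finset.sum_congr rfl fun β _ => by rw [dif_pos β.2]) α.1 (hI α)
      rwa [dif_pos α.2] at this
    obtain ⟨G, hG⟩ := A.exists_leftInverse_of_injective hA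
    refine ⟨(B.comp G).comp (Submodule.subtype _), fun α σ hα => ?_⟩
    let a : S := ⟨α, Finset.mem_piAntidiag.2 ⟨hα, fun _ _ => Finset.mem_univ _⟩⟩
    let c : S → (Tangent (subsimplex T F)) [⋀^Fin k]→ₗ[ℝ] 𝕂 :=
      Pi.single a (wedge 𝕂 fun j => dbary (subsimplex T F) (σ j))
    have hc : A c = polyForm 𝕂 (subsimplex T F) α (fun j => dbary (subsimplex T F) (σ j)) := by
      funext x
      change ∑ β, (baryMonomial (subsimplex T F) β.1 x : 𝕂) • c β = _
      rw [Finset.sum_eq_single a]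
      · simp [c, polyForm, a]
      · intro β _ hβ
        simp [c, hβ]
      · simp
    refine (congrArg (fun z => B (G z)) hc.symm).trans ?_
    change B ((G.comp A) c) = _
    rw [hG, LinearMap.id_apply]
    funext x
    change ∑ β, (baryMonomial T (extIdx F β.1) x : 𝕂) • (c β).compLinearMap (L β) = _
    rw [Finset.sum_eq_single a]
    · simp only [c, Pi.single_eq_same, wedge_compLinearMap, hL]
      rfl
    · intro β _ hβ
      simp [c, hβ]
    · simp
  · intro E E' h h'
    refine LinearMap.ext fun ⟨ω, hω⟩ => ?_
    induction hω using Submodule.span_induction with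
    | mem ω hω =>
      obtain ⟨α, σ, hα, rfl⟩ := hω
      exact (h α σ hα).trans (h' α σ hα).symm
    | zero => exact (map_zero E).trans (map_zero E').symm
    | add x y hx hy ihx ihy =>
      exact (map_add E ⟨x, hx⟩ ⟨y, hy⟩).trans ((congrArg₂ (· + ·) ihx ihy).trans
        (map_add E' ⟨x, hx⟩ ⟨y, hy⟩).symm)
    | smul a x hx ih =>
      exact (map_smul E a ⟨x, hx⟩).trans ((congrArg (a • ·) ih).trans
        (map_smul E' a ⟨x, hx⟩).symm)

/-- The extension operator `ext_{F,T}^{r,k}` on `𝒫̊_rΛ^k(F)`, for `r ≥ 1`: the linear map with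
`λ_F^α dλ_{σ(1)} ∧ ⋯ ∧ dλ_{σ(k)} ↦ λ_T^α̃ Ψ_{σ̃(1)} ∧ ⋯ ∧ Ψ_{σ̃(k)}`. -/
def extOp (T : Affine.Simplex ℝ P n) (F : Subsimplex n) {r : ℕ} (hr : 0 < r) (k : ℕ) :
    polySpace₀ 𝕂 (subsimplex T F) r k →ₗ[𝕂] Form 𝕂 T k :=
  (existsUnique_ext 𝕂 T F hr k).choose.comp
    (Submodule.inclusion (polySpace₀_le 𝕂 (subsimplex T F) r k))

end Forms

section Invariance

variable {𝕂 : Type*} [RCLike 𝕂] {W : Type*} [AddCommGroup W] [Module 𝕂 W]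

/-- `Q` is a (finite) basis of the subspace `U`. -/
def IsBasisOf (Q : Set W) (U : Submodule 𝕂 W) : Prop :=
  Q.Finite ∧ LinearIndepOn 𝕂 id Q ∧ Submodule.span 𝕂 Q = U

/-- A finite set `Q` is `𝕂`-invariant under operators `ρ g` if each `ρ g` permutes the elements
of `Q` up to multiplication by nonzero elements of `𝕂`. -/
def IsInvariantSet {G : Type*} (ρ : G → W →ₗ[𝕂] W) (Q : Set W) : Prop :=
  Q.Finite ∧ ∀ g, ∃ (τ : Equiv.Perm Q) (χ : Q → 𝕂),
    (∀ ω, χ ω ≠ 0) ∧ ∀ ω : Q, ρ g ω = χ ω • (τ ω : W)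

/-- Two sets of vectors agree up to multiplication of their members by nonzero scalars. -/
def EqUpToUnits (𝕂 : Type*) [RCLike 𝕂] {W : Type*} [AddCommGroup W] [Module 𝕂 W]
    (A B : Set W) : Prop :=
  (∀ a ∈ A, ∃ χ : 𝕂, χ ≠ 0 ∧ χ • a ∈ B) ∧ ∀ b ∈ B, ∃ χ : 𝕂, χ ≠ 0 ∧ χ • b ∈ A

end Invariance

end SimplexForms

end

open SimplexForms

noncomputable section

namespace SimplexForms

open Finset

/-! ### Pullbacks of barycentric coordinates and of polynomial forms -/

section Pullback

variable (𝕂 : Type*) [RCLike 𝕂]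
variable {V P : Type*} [AddCommGroup V] [Module ℝ V] [AddTorsor V P] {n m : ℕ}

/-! Geometric decomposition: `polySpace` is the direct sum of the extended spaces `polySpace₀`, one
for each subsimplex, so bases of the summands combine to a basis; the symmetries permute the
summands.

Spanning (`iSup_map_extLin`). Let `F` be the set of vertices that occur in a generator, in its
exponent or in its differentials. Since the `dλ_l` sum to zero, `Ψ_i` is `dλ_i` plus a multiple,
proportional to the exponent at `i`, of the sum of the `dλ_l` over `l` outside `F`. So the extension
from `F` reproduces the generator up to terms in which strictly more vertices occur, and induction
applies.

Directness (`iSupIndep_map_extLin`). The trace on `F` undoes the extension from `F`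
(`trace_extLin_self`) and kills the extension from every `G` not contained in `F`
(`trace_extLin_eq_zero`). A vanishing sum of extensions is thus a triangular system, solved by
induction on the number of vertices.

Invariance. Extension commutes with symmetries (`symmPullback_extLin`), so compatibility of the
bases makes each `S_π^*` take members of the union to nonzero multiples of members. Injectivity
turns this into a permutation (`isInvariantSet_of_exists_smul`). -/

theorem bary_simplexMap (T : Affine.Simplex ℝ P n) (T' : Affine.Simplex ℝ P m)
    (f : Fin (n + 1) → Fin (m + 1)) (x : Carrier T) (j : Fin (m + 1)) :
    bary T' j (simplexMap T T' f x) = ∑ i, bary T i x * if j = f i then 1 else 0 := by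
  have hsum : ∑ i, (vertexBasis T).coords x i = 1 := (vertexBasis T).sum_coord_apply_eq_one _
  rw [simplexMap, AffineMap.comp_apply, Finset.map_affineCombination _ _ _ hsum,
    Finset.affineCombination_eq_linear_combination _ _ _ hsum]
  simp only [Function.comp, bary, AffineBasis.coord_apply, smul_eq_mul, AffineBasis.coords_apply]

theorem bary_simplexMap_apply (T : Affine.Simplex ℝ P n) (T' : Affine.Simplex ℝ P m)
    {f : Fin (n + 1) → Fin (m + 1)} (hf : f.Injective) (x : Carrier T) (i : Fin (n + 1)) :
    bary T' (f i) (simplexMap T T' f x) = bary T i x := by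
  rw [bary_simplexMap]
  simp [hf.eq_iff]

theorem bary_simplexMap_of_notMem (T : Affine.Simplex ℝ P n) (T' : Affine.Simplex ℝ P m)
    {f : Fin (n + 1) → Fin (m + 1)} (x : Carrier T) {j : Fin (m + 1)} (hj : j ∉ Set.range f) :
    bary T' j (simplexMap T T' f x) = 0 := by
  rw [bary_simplexMap]
  exact Finset.sum_eq_zero fun i _ => by rw [if_neg fun h => hj ⟨i, h.symm⟩, mul_zero]

theorem dbary_comp_simplexMap (T : Affine.Simplex ℝ P n) (T' : Affine.Simplex ℝ P m)
    {f : Fin (n + 1) → Fin (m + 1)} (hf : f.Injective) (i : Fin (n + 1)) :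
    (dbary T' (f i)).comp (simplexMap T T' f).linear = dbary T i := by
  have h : (bary T' (f i)).comp (simplexMap T T' f) = bary T i :=
    AffineMap.ext fun x => bary_simplexMap_apply T T' hf x i
  exact congrArg AffineMap.linear h

theorem dbary_comp_simplexMap_of_notMem (T : Affine.Simplex ℝ P n) (T' : Affine.Simplex ℝ P m)
    {f : Fin (n + 1) → Fin (m + 1)} {j : Fin (m + 1)} (hj : j ∉ Set.range f) :
    (dbary T' j).comp (simplexMap T T' f).linear = 0 := by
  have h : (bary T' j).comp (simplexMap T T' f) = AffineMap.const ℝ _ 0 :=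
    AffineMap.ext fun x => bary_simplexMap_of_notMem T T' x hj
  exact congrArg AffineMap.linear h

theorem sum_dbary (T : Affine.Simplex ℝ P n) : ∑ i, dbary T i = 0 := by
  have h : ∑ i, bary T i = AffineMap.const ℝ _ 1 := by
    ext x
    have hx := (vertexBasis T).sum_coord_apply_eq_one x
    have h2 : (∑ i, bary T i) x = ∑ i, bary T i x :=
      map_sum (AddMonoidHom.mk' (fun d : Carrier T →ᵃ[ℝ] ℝ => d x) fun _ _ => rfl) _ _
    rw [h2]
    exact hx
  have h3 : (∑ i, bary T i).linear = ∑ i, (bary T i).linear :=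
    map_sum (AddMonoidHom.mk' (fun d : Carrier T →ᵃ[ℝ] ℝ => d.linear) fun _ _ => rfl) _ _
  simp only [dbary]
  rw [← h3, h]
  rfl

/-- Coordinates off the range of `f` vanish on the image; `hα` ensures that they do not enter the
monomial. -/
theorem pullback_polyForm {k : ℕ} (T : Affine.Simplex ℝ P n) (T' : Affine.Simplex ℝ P m)
    {f : Fin (n + 1) → Fin (m + 1)} (hf : f.Injective) (α : Fin (m + 1) → ℕ)
    (hα : ∀ j ∉ Set.range f, α j = 0) (g : Fin k → Module.Dual ℝ (Tangent T')) :
    pullback 𝕂 T T' f k (polyForm 𝕂 T' α g)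
      = polyForm 𝕂 T (α ∘ f) (fun j => (g j).comp (simplexMap T T' f).linear) := by
  funext x
  have h : baryMonomial T' α (simplexMapOn T T' f x) = baryMonomial T (α ∘ f) x := by
    refine (Fintype.prod_of_injective f hf _ _ (fun j hj => ?_) fun i => ?_).symm
    · rw [hα j hj, pow_zero]
    · rw [← bary_simplexMap_apply T T' hf (toCarrier x) i]
      rfl
  change (baryMonomial T' α (simplexMapOn T T' f x) : 𝕂) •
    (wedge 𝕂 fun j => (g j).comp (simplexMap T T' f).linear) = _
  rw [h]
  rfl

/-- On the image, `λ_j` is identically zero. Hence a factor `λ_j` kills the monomial, and a factor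
`dλ_j` gives the determinant a zero column. -/
theorem pullback_polyForm_eq_zero {k : ℕ} (T : Affine.Simplex ℝ P n) (T' : Affine.Simplex ℝ P m)
    {f : Fin (n + 1) → Fin (m + 1)} {α : Fin (m + 1) → ℕ} {j : Fin (m + 1)}
    (hj : j ∉ Set.range f) (g : Fin k → Module.Dual ℝ (Tangent T'))
    (h : 0 < α j ∨ ∃ l, g l = dbary T' j) :
    pullback 𝕂 T T' f k (polyForm 𝕂 T' α g) = 0 := by
  funext x
  change (baryMonomial T' α (simplexMapOn T T' f x) : 𝕂) •
    (wedge 𝕂 fun j => (g j).comp (simplexMap T T' f).linear) = 0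
  rcases h with h | ⟨l, h⟩
  · have h0 : baryMonomial T' α (simplexMapOn T T' f x) = 0 := by
      refine Finset.prod_eq_zero (Finset.mem_univ j) ?_
      have h1 : bary T' j (toCarrier (simplexMapOn T T' f x)) = 0 :=
        bary_simplexMap_of_notMem T T' (toCarrier x) hj
      rw [h1, zero_pow h.ne']
    rw [h0, RCLike.ofReal_zero, zero_smul]
  · have h0 : (wedge 𝕂 fun j => (g j).comp (simplexMap T T' f).linear) = 0 := by
      ext w
      have hd : Matrix.det (fun i j => (g j).comp (simplexMap T T' f).linear (w i)) = 0 := by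
        refine Matrix.det_eq_zero_of_column_eq_zero l fun i => ?_
        rw [h, dbary_comp_simplexMap_of_notMem T T' hj, LinearMap.zero_apply]
      exact (congrArg (Algebra.linearMap ℝ 𝕂) hd).trans (map_zero _)
    rw [h0, smul_zero]

end Pullback

/-! ### Exterior products over arbitrary index tuples -/

section Wedge

variable (𝕂 : Type*) [RCLike 𝕂]
variable {V P : Type*} [AddCommGroup V] [Module ℝ V] [AddTorsor V P] {n : ℕ}

theorem wedge_apply {W : Type*} [AddCommGroup W] [Module ℝ W] {k : ℕ}
    (f : Fin k → Module.Dual ℝ W) (w : Fin k → W) :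
    wedge 𝕂 f w = ((Matrix.of fun i j => f j (w i)).det : 𝕂) := rfl

theorem wedge_comp_perm {W : Type*} [AddCommGroup W] [Module ℝ W] {k : ℕ}
    (f : Fin k → Module.Dual ℝ W) (p : Equiv.Perm (Fin k)) :
    wedge 𝕂 (f ∘ p) = ((Equiv.Perm.sign p : ℤ) : 𝕂) • wedge 𝕂 f := by
  ext w
  rw [AlternatingMap.smul_apply, wedge_apply, wedge_apply]
  have h := Matrix.det_permute' p (Matrix.of fun i j => f j (w i))
  refine (congrArg (fun t : ℝ => (t : 𝕂)) h).trans ?_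
  push_cast
  rfl

theorem wedge_eq_zero {W : Type*} [AddCommGroup W] [Module ℝ W] {k : ℕ}
    (f : Fin k → Module.Dual ℝ W) (hf : ¬ f.Injective) : wedge 𝕂 f = 0 := by
  ext w
  simp only [Function.Injective, not_forall] at hf
  obtain ⟨i, j, h, hij⟩ := hf
  rw [wedge_apply, Matrix.det_zero_of_column_eq hij fun l => by simp [h], RCLike.ofReal_zero]
  rfl

theorem wedge_sum {W : Type*} [AddCommGroup W] [Module ℝ W] {k : ℕ} {ι : Type*} [Fintype ι]
    (A : Fin k → ι → ℝ) (f : ι → Module.Dual ℝ W) :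
    wedge 𝕂 (fun j => ∑ i, A j i • f i)
      = ∑ τ : Fin k → ι, ((∏ j, A j (τ j) : ℝ) : 𝕂) • wedge 𝕂 (fun j => f (τ j)) := by
  classical
  ext w
  rw [sum_alt_apply]
  simp only [AlternatingMap.smul_apply, wedge_apply, smul_eq_mul]
  -- The one-forms index columns, while the determinant is packaged as multilinear in rows.
  rw [← Matrix.det_transpose]
  have h := (Matrix.detRowAlternating (n := Fin k) (R := ℝ)).toMultilinearMap.map_sum
    (fun j i => A j i • fun l => f i (w l))
  have h2 : (Matrix.of fun i j => (∑ i, A j i • f i) (w i)).transpose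
      = fun j => ∑ i, A j i • fun l => f i (w l) := by
    ext j l
    simp
  rw [h2]
  refine (congrArg (fun t : ℝ => (t : 𝕂)) h).trans ?_
  rw [RCLike.ofReal_sum]
  refine Finset.sum_congr rfl fun τ _ => ?_
  rw [← RCLike.ofReal_mul]
  congr 1
  rw [MultilinearMap.map_smul_univ, ← Matrix.det_transpose]
  rfl

theorem polyForm_comp_perm (T : Affine.Simplex ℝ P n) {k : ℕ} (α : Fin (n + 1) → ℕ)
    (f : Fin k → Module.Dual ℝ (Tangent T)) (p : Equiv.Perm (Fin k)) :
    polyForm 𝕂 T α (f ∘ p) = ((Equiv.Perm.sign p : ℤ) : 𝕂) • polyForm 𝕂 T α f := by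
  funext x
  simp only [polyForm, Pi.smul_apply, wedge_comp_perm, smul_comm (_ : 𝕂) ((Equiv.Perm.sign p : ℤ) : 𝕂)]

theorem polyForm_eq_zero (T : Affine.Simplex ℝ P n) {k : ℕ} (α : Fin (n + 1) → ℕ)
    (f : Fin k → Module.Dual ℝ (Tangent T)) (hf : ¬ f.Injective) : polyForm 𝕂 T α f = 0 := by
  funext x
  simp [polyForm, wedge_eq_zero 𝕂 f hf]

theorem polyForm_sum (T : Affine.Simplex ℝ P n) {k : ℕ} (α : Fin (n + 1) → ℕ)
    {ι : Type*} [Fintype ι] (A : Fin k → ι → ℝ) (f : ι → Module.Dual ℝ (Tangent T)) :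
    polyForm 𝕂 T α (fun j => ∑ i, A j i • f i)
      = ∑ τ : Fin k → ι, ((∏ j, A j (τ j) : ℝ) : 𝕂) • polyForm 𝕂 T α (fun j => f (τ j)) := by
  funext x
  rw [Finset.sum_apply]
  simp only [polyForm, Pi.smul_apply, wedge_sum, Finset.smul_sum]
  exact Finset.sum_congr rfl fun τ _ => smul_comm _ _ _

/-- An injective tuple is a permutation of a strictly increasing one. -/
theorem exists_orderEmbedding_comp_perm {ι : Type*} [LinearOrder ι] {k : ℕ} (τ : Fin k → ι)
    (hτ : τ.Injective) : ∃ (σ : Fin k ↪o ι) (p : Equiv.Perm (Fin k)), τ = σ ∘ p := by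
  have h : StrictMono (τ ∘ Tuple.sort τ) :=
    (Tuple.monotone_sort τ).strictMono_of_injective (hτ.comp (Tuple.sort τ).injective)
  refine ⟨OrderEmbedding.ofStrictMono _ h, (Tuple.sort τ).symm, ?_⟩
  funext j
  simp

/-- Sorting an injective tuple costs a sign and keeps its range; a tuple with a repetition gives the
zero form. This frees later expansions from increasing tuples. -/
theorem polyForm_mem_polySpace₀ (T : Affine.Simplex ℝ P n) {r k : ℕ} {α : Fin (n + 1) → ℕ}
    (hα : ∑ i, α i = r) (τ : Fin k → Fin (n + 1)) (h : ∀ i, 0 < α i ∨ i ∈ Set.range τ) :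
    polyForm 𝕂 T α (fun j => dbary T (τ j)) ∈ polySpace₀ 𝕂 T r k := by
  by_cases hτ : τ.Injective
  · obtain ⟨σ, p, rfl⟩ := exists_orderEmbedding_comp_perm τ hτ
    rw [show (fun j => dbary T ((σ ∘ p) j)) = (fun j => dbary T (σ j)) ∘ p from rfl,
      polyForm_comp_perm]
    refine Submodule.smul_mem _ _ (Submodule.subset_span ⟨α, σ, hα, fun i => ?_, rfl⟩)
    simpa [EquivLike.range_comp] using h i
  · rw [polyForm_eq_zero]
    · exact Submodule.zero_mem _
    · exact fun h => hτ (Function.Injective.of_comp (f := dbary T) h)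

theorem polyForm_mem_polySpace (T : Affine.Simplex ℝ P n) {r k : ℕ} {α : Fin (n + 1) → ℕ}
    (hα : ∑ i, α i = r) (τ : Fin k → Fin (n + 1)) :
    polyForm 𝕂 T α (fun j => dbary T (τ j)) ∈ polySpace 𝕂 T r k := by
  by_cases hτ : τ.Injective
  · obtain ⟨σ, p, rfl⟩ := exists_orderEmbedding_comp_perm τ hτ
    rw [show (fun j => dbary T ((σ ∘ p) j)) = (fun j => dbary T (σ j)) ∘ p from rfl,
      polyForm_comp_perm]
    exact Submodule.smul_mem _ _ (Submodule.subset_span ⟨α, σ, hα, rfl⟩)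
  · rw [polyForm_eq_zero]
    · exact Submodule.zero_mem _
    · exact fun h => hτ (Function.Injective.of_comp (f := dbary T) h)

end Wedge

/-! ### Extension operators as linear maps on all forms -/

section Extension

variable (𝕂 : Type*) [RCLike 𝕂]
variable {V P : Type*} [AddCommGroup V] [Module ℝ V] [AddTorsor V P] {n : ℕ}

theorem Subsimplex.incl_mem (F : Subsimplex n) (i : Fin (F.dim + 1)) : F.incl i ∈ F.1 :=
  F.1.orderEmbOfFin_mem F.card_eq i

theorem Subsimplex.range_incl (F : Subsimplex n) : Set.range F.incl = F.1 :=
  F.1.range_orderEmbOfFin F.card_eq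

theorem Subsimplex.exists_incl_eq (F : Subsimplex n) {i : Fin (n + 1)} (hi : i ∈ F.1) :
    ∃ a, F.incl a = i := by
  have h : i ∈ Set.range F.incl := by rw [F.range_incl]; exact hi
  exact h

theorem extIdx_of_notMem (F : Subsimplex n) (α : Fin (F.dim + 1) → ℕ) {i : Fin (n + 1)}
    (hi : i ∉ F.1) : extIdx F α i = 0 := by
  refine Function.extend_apply' _ _ _ ?_
  rintro ⟨a, rfl⟩
  exact hi (F.incl_mem a)

theorem eq_extIdx_iff (F : Subsimplex n) (α : Fin (F.dim + 1) → ℕ) (β : Fin (n + 1) → ℕ) :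
    β = extIdx F α ↔ (∀ a, β (F.incl a) = α a) ∧ ∀ i ∉ F.1, β i = 0 := by
  constructor
  · rintro rfl
    exact ⟨extIdx_incl F α, fun i hi => extIdx_of_notMem F α hi⟩
  · rintro ⟨h1, h2⟩
    funext i
    by_cases hi : i ∈ F.1
    · obtain ⟨a, rfl⟩ := F.exists_incl_eq hi
      rw [h1, extIdx_incl]
    · rw [h2 i hi, extIdx_of_notMem F α hi]

/-- The extension operator is the restriction of a linear map on all forms, which satisfies the
defining formula also for tuples `τ` that need not be increasing. -/
theorem exists_linearMap_extending_extOp (T : Affine.Simplex ℝ P n) (F : Subsimplex n) {r : ℕ}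
    (hr : 0 < r) (k : ℕ) : ∃ E : Form 𝕂 (subsimplex T F) k →ₗ[𝕂] Form 𝕂 T k,
      (∀ ω : polySpace₀ 𝕂 (subsimplex T F) r k, extOp 𝕂 T F hr k ω = E ω) ∧
      ∀ (α : Fin (F.dim + 1) → ℕ) (τ : Fin k → Fin (F.dim + 1)), ∑ i, α i = r →
        E (polyForm 𝕂 (subsimplex T F) α (fun j => dbary (subsimplex T F) (τ j)))
          = polyForm 𝕂 T (extIdx F α) (fun j => Psi T F (extIdx F α) (F.incl (τ j))) := by
  obtain ⟨E, hE⟩ := LinearMap.exists_extend (existsUnique_ext 𝕂 T F hr k).choose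
  have hE' : ∀ ω : polySpace 𝕂 (subsimplex T F) r k,
      E ω = (existsUnique_ext 𝕂 T F hr k).choose ω := fun ω => LinearMap.congr_fun hE ω
  refine ⟨E, fun ω => (hE' _).symm, fun α τ hα => ?_⟩
  by_cases hτ : τ.Injective
  · obtain ⟨σ, p, rfl⟩ := exists_orderEmbedding_comp_perm τ hτ
    rw [show (fun j => dbary (subsimplex T F) ((σ ∘ p) j))
        = (fun j => dbary (subsimplex T F) (σ j)) ∘ p from rfl,
      show (fun j => Psi T F (extIdx F α) (F.incl ((σ ∘ p) j)))
        = (fun j => Psi T F (extIdx F α) (F.incl (σ j))) ∘ p from rfl,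
      polyForm_comp_perm, polyForm_comp_perm, map_smul]
    congr 1
    exact (hE' ⟨_, Submodule.subset_span ⟨α, σ, hα, rfl⟩⟩).trans
      ((existsUnique_ext 𝕂 T F hr k).choose_spec.1 α σ hα)
  · rw [polyForm_eq_zero, polyForm_eq_zero, map_zero]
    · exact fun h => hτ (Function.Injective.of_comp
        (f := fun i => Psi T F (extIdx F α) (F.incl i)) h)
    · exact fun h => hτ (Function.Injective.of_comp (f := dbary (subsimplex T F)) h)

/-- A linear map on all forms that restricts to the extension operator. -/
def extLin (T : Affine.Simplex ℝ P n) (F : Subsimplex n) {r : ℕ} (hr : 0 < r) (k : ℕ) :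
    Form 𝕂 (subsimplex T F) k →ₗ[𝕂] Form 𝕂 T k :=
  (exists_linearMap_extending_extOp 𝕂 T F hr k).choose

theorem extOp_eq_extLin (T : Affine.Simplex ℝ P n) (F : Subsimplex n) {r : ℕ} (hr : 0 < r) (k : ℕ)
    (ω : polySpace₀ 𝕂 (subsimplex T F) r k) : extOp 𝕂 T F hr k ω = extLin 𝕂 T F hr k ω :=
  (exists_linearMap_extending_extOp 𝕂 T F hr k).choose_spec.1 ω

theorem extLin_polyForm (T : Affine.Simplex ℝ P n) (F : Subsimplex n) {r : ℕ} (hr : 0 < r) {k : ℕ}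
    {α : Fin (F.dim + 1) → ℕ} (hα : ∑ i, α i = r) (τ : Fin k → Fin (F.dim + 1)) :
    extLin 𝕂 T F hr k
        (polyForm 𝕂 (subsimplex T F) α (fun j => dbary (subsimplex T F) (τ j)))
      = polyForm 𝕂 T (extIdx F α) (fun j => Psi T F (extIdx F α) (F.incl (τ j))) :=
  (exists_linearMap_extending_extOp 𝕂 T F hr k).choose_spec.2 α τ hα

/-! ### The extended spaces span -/

/-- The coefficients of `Psi` as a combination of differentials, in which those of the vertices
of `F` enter only through `dλ_i` itself. -/
def psiCoeff (F : Subsimplex n) (α : Fin (n + 1) → ℕ) (i l : Fin (n + 1)) : ℝ :=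
  if l = i then 1 else if l ∈ F.1 then 0 else (α i : ℝ) / ((∑ j, α j : ℕ) : ℝ)

/-- All `dλ_l` together sum to zero, so subtracting `c` times the sum over `F` is adding `c` times
the sum over its complement. -/
theorem Psi_eq_sum (T : Affine.Simplex ℝ P n) (F : Subsimplex n) (α : Fin (n + 1) → ℕ)
    {i : Fin (n + 1)} (hi : i ∈ F.1) : Psi T F α i = ∑ l, psiCoeff F α i l • dbary T l := by
  set c : ℝ := (α i : ℝ) / ((∑ j, α j : ℕ) : ℝ) with hc
  have h : ∀ l, psiCoeff F α i l • dbary T l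
      = (if l = i then dbary T l else 0) + if l ∈ F.1 then 0 else c • dbary T l := by
    intro l
    by_cases hl : l = i
    · subst hl
      simp [psiCoeff, hi]
    · by_cases hF : l ∈ F.1 <;> simp [psiCoeff, hl, hF, hc]
  have h2 : ∑ l, (if l ∈ F.1 then 0 else c • dbary T l) = - (c • ∑ l ∈ F.1, dbary T l) := by
    have h3 : ∑ l, (if l ∈ F.1 then c • dbary T l else 0) = c • ∑ l ∈ F.1, dbary T l := by
      rw [Finset.sum_ite_mem, Finset.univ_inter, Finset.smul_sum]
    have h4 : ∑ l, c • dbary T l = 0 := by rw [← Finset.smul_sum, sum_dbary, smul_zero]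
    rw [eq_neg_iff_add_eq_zero, ← h3, ← Finset.sum_add_distrib]
    refine Eq.trans ?_ h4
    exact Finset.sum_congr rfl fun l _ => by split_ifs <;> simp
  rw [Finset.sum_congr rfl fun l _ => h l, Finset.sum_add_distrib, h2, Finset.sum_ite_eq' univ i,
    if_pos (Finset.mem_univ i), ← sub_eq_add_neg]
  rfl

theorem polyForm_Psi (T : Affine.Simplex ℝ P n) (F : Subsimplex n) {k : ℕ} (α β : Fin (n + 1) → ℕ)
    {τ : Fin k → Fin (n + 1)} (hτ : ∀ j, τ j ∈ F.1) :
    polyForm 𝕂 T β (fun j => Psi T F α (τ j)) = ∑ ρ : Fin k → Fin (n + 1),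
      ((∏ j, psiCoeff F α (τ j) (ρ j) : ℝ) : 𝕂) • polyForm 𝕂 T β (fun j => dbary T (ρ j)) := by
  rw [← polyForm_sum]
  congr 1
  funext j
  exact Psi_eq_sum T F α (hτ j)

theorem map_extLin_le (T : Affine.Simplex ℝ P n) (F : Subsimplex n) {r : ℕ} (hr : 0 < r) (k : ℕ) :
    (polySpace₀ 𝕂 (subsimplex T F) r k).map (extLin 𝕂 T F hr k) ≤ polySpace 𝕂 T r k := by
  rw [polySpace₀, Submodule.map_span_le]
  rintro _ ⟨α, σ, hα, -, rfl⟩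
  rw [extLin_polyForm 𝕂 T F hr hα, polyForm_Psi 𝕂 T F _ _ fun j => F.incl_mem (σ j)]
  exact Submodule.sum_mem _ fun ρ _ => Submodule.smul_mem _ _
    (polyForm_mem_polySpace 𝕂 T ((sum_extIdx F α).trans hα) ρ)

theorem polyForm_mem_iSup_map_extLin (T : Affine.Simplex ℝ P n) {r : ℕ} (hr : 0 < r) {k : ℕ}
    {α : Fin (n + 1) → ℕ} (hα : ∑ i, α i = r) (τ : Fin k → Fin (n + 1)) :
    polyForm 𝕂 T α (fun j => dbary T (τ j)) ∈
      ⨆ F, (polySpace₀ 𝕂 (subsimplex T F) r k).map (extLin 𝕂 T F hr k) := by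
  classical
  -- The induction runs over the number of vertices that do not occur in the form; these are the
  -- vertices outside the `F` chosen next.
  induction hN : #{i | α i = 0 ∧ i ∉ Set.range τ} using Nat.strong_induction_on generalizing τ with
  | _ N ih =>
  let F : Subsimplex n := ⟨univ.filter fun i => 0 < α i ∨ i ∈ Set.range τ, by
    -- Nonemptiness of `F` uses `r ≥ 1`: some exponent is positive.
    obtain ⟨i, _, hi⟩ := Finset.exists_ne_zero_of_sum_ne_zero (hα.trans_ne hr.ne')
    exact ⟨i, by simp [Nat.pos_of_ne_zero hi]⟩⟩
  have hF : ∀ i, i ∈ F.1 ↔ 0 < α i ∨ i ∈ Set.range τ := fun i => by simp [F]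
  have hτF : ∀ j, τ j ∈ F.1 := fun j => (hF _).2 (Or.inr ⟨j, rfl⟩)
  choose τ' hτ' using fun j => F.exists_incl_eq (hτF j)
  let α' : Fin (F.dim + 1) → ℕ := fun a => α (F.incl a)
  have hαα' : α = extIdx F α' := (eq_extIdx_iff F α' α).2 ⟨fun _ => rfl, fun i hi => by
    rw [hF, not_or] at hi
    omega⟩
  have hα' : ∑ a, α' a = r := by rw [← hα, ← sum_extIdx, ← hαα']
  have hE := extLin_polyForm 𝕂 T F hr hα' τ'
  rw [← hαα'] at hE
  simp only [hτ'] at hE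
  -- The term `ρ = τ` has coefficient `1`, so the given form is the extension minus the terms with
  -- `ρ ≠ τ`.
  rw [polyForm_Psi 𝕂 T F α α hτF, ← Finset.add_sum_erase univ _ (Finset.mem_univ τ),
    Finset.prod_eq_one fun j _ => by simp [psiCoeff], RCLike.ofReal_one, one_smul,
    ← sub_eq_iff_eq_add] at hE
  rw [← hE]
  refine Submodule.sub_mem _ (Submodule.mem_iSup_of_mem F (Submodule.mem_map_of_mem ?_)) ?_
  · refine polyForm_mem_polySpace₀ 𝕂 _ hα' τ' fun a => ?_
    refine ((hF _).1 (F.incl_mem a)).imp id ?_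
    rintro ⟨j, hj⟩
    exact ⟨j, F.incl.injective ((hτ' j).trans hj)⟩
  · refine Submodule.sum_mem _ fun ρ hρ => ?_
    by_cases h0 : ∏ j, psiCoeff F α (τ j) (ρ j) = 0
    · rw [h0, RCLike.ofReal_zero, zero_smul]
      exact Submodule.zero_mem _
    replace h0 := Finset.prod_ne_zero_iff.1 h0
    refine Submodule.smul_mem _ _ (ih _ ?_ ρ rfl)
    rw [← hN]
    -- In a surviving term, an index can only be replaced by one outside `F`, and only if its
    -- exponent is positive.
    have h1 : ∀ j, ρ j ≠ τ j → ρ j ∉ F.1 ∧ α (τ j) ≠ 0 := by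
      intro j hj
      have := h0 j (Finset.mem_univ j)
      rw [psiCoeff, if_neg hj] at this
      constructor
      · intro h
        exact this (if_pos h)
      · intro h
        simp [h] at this
    apply Finset.card_lt_card
    rw [Finset.ssubset_iff_of_subset]
    -- Strictness: a replacement `ρ j` did not occur before and occurs now.
    · obtain ⟨j, hj⟩ := Function.ne_iff.1 (Finset.ne_of_mem_erase hρ)
      refine ⟨ρ j, ?_, by simp⟩
      have := (h1 j hj).1
      rw [hF, not_or] at this
      rw [Finset.mem_filter]
      exact ⟨Finset.mem_univ _, by omega, this.2⟩
    -- No vertex is lost: an index dropped from `τ` still occurs through its positive exponent.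
    · intro i
      simp only [Finset.mem_filter, Finset.mem_univ, true_and]
      rintro ⟨hi, hiρ⟩
      refine ⟨hi, ?_⟩
      rintro ⟨j, rfl⟩
      by_cases hj : ρ j = τ j
      · exact hiρ ⟨j, hj⟩
      · exact (h1 j hj).2 hi

theorem iSup_map_extLin (T : Affine.Simplex ℝ P n) {r : ℕ} (hr : 0 < r) (k : ℕ) :
    ⨆ F, (polySpace₀ 𝕂 (subsimplex T F) r k).map (extLin 𝕂 T F hr k) = polySpace 𝕂 T r k := by
  refine le_antisymm (iSup_le fun F => map_extLin_le 𝕂 T F hr k) (Submodule.span_le.2 ?_)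
  rintro _ ⟨α, σ, hα, rfl⟩
  exact polyForm_mem_iSup_map_extLin 𝕂 T hr hα σ

/-! ### Traces on subsimplices and directness of the sum -/

theorem sum_comp_linearMap {A B C ι : Type*} [AddCommGroup A] [Module ℝ A] [AddCommGroup B]
    [Module ℝ B] [AddCommGroup C] [Module ℝ C] (s : Finset ι) (f : ι → B →ₗ[ℝ] C) (L : A →ₗ[ℝ] B) :
    (∑ i ∈ s, f i).comp L = ∑ i ∈ s, (f i).comp L :=
  map_sum (LinearMap.lcomp ℝ C L) f s

/-- The correction term is a multiple of the sum of `dλ_j` over the vertices of `F`, which restricts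
on `F` to the differential of the constant `1`. -/
theorem Psi_comp_simplexMap_incl (T : Affine.Simplex ℝ P n) (F : Subsimplex n)
    (α : Fin (n + 1) → ℕ) (i : Fin (F.dim + 1)) :
    (Psi T F α (F.incl i)).comp (simplexMap (subsimplex T F) T F.incl).linear
      = dbary (subsimplex T F) i := by
  rw [Psi, LinearMap.sub_comp, LinearMap.smul_comp, sum_incl, sum_comp_linearMap]
  simp only [dbary_comp_simplexMap _ T F.incl.injective, sum_dbary, smul_zero, sub_zero]

theorem trace_extLin_self (T : Affine.Simplex ℝ P n) (F : Subsimplex n) {r : ℕ} (hr : 0 < r)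
    {k : ℕ} {ω : Form 𝕂 (subsimplex T F) k} (hω : ω ∈ polySpace₀ 𝕂 (subsimplex T F) r k) :
    pullback 𝕂 (subsimplex T F) T F.incl k (extLin 𝕂 T F hr k ω) = ω := by
  refine LinearMap.eqOn_span
    (f := (pullback 𝕂 (subsimplex T F) T F.incl k).comp (extLin 𝕂 T F hr k))
    (g := LinearMap.id) ?_ hω
  rintro _ ⟨α, σ, hα, -, rfl⟩
  rw [LinearMap.comp_apply, extLin_polyForm 𝕂 T F hr hα,
    pullback_polyForm 𝕂 _ T F.incl.injective _ fun j hj => extIdx_of_notMem F α fun h => hj (by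
      rwa [F.range_incl]),
    show extIdx F α ∘ F.incl = α from funext (extIdx_incl F α), LinearMap.id_apply]
  simp only [Psi_comp_simplexMap_incl]

/-- A vertex of `G` outside `F` occurs in each generator over `G`. Its coordinate vanishes on `F`,
and so does the extended generator's trace. -/
theorem trace_extLin_eq_zero (T : Affine.Simplex ℝ P n) {F G : Subsimplex n} (hFG : ¬ G.1 ⊆ F.1)
    {r : ℕ} (hr : 0 < r) {k : ℕ} {ω : Form 𝕂 (subsimplex T G) k}
    (hω : ω ∈ polySpace₀ 𝕂 (subsimplex T G) r k) :
    pullback 𝕂 (subsimplex T F) T F.incl k (extLin 𝕂 T G hr k ω) = 0 := by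
  refine LinearMap.eqOn_span
    (f := (pullback 𝕂 (subsimplex T F) T F.incl k).comp (extLin 𝕂 T G hr k))
    (g := 0) ?_ hω
  rintro _ ⟨α, σ, hα, h, rfl⟩
  obtain ⟨i, hiG, hiF⟩ := Finset.not_subset.1 hFG
  obtain ⟨a, rfl⟩ := G.exists_incl_eq hiG
  rw [LinearMap.comp_apply, extLin_polyForm 𝕂 T G hr hα, LinearMap.zero_apply]
  refine pullback_polyForm_eq_zero 𝕂 _ T (j := G.incl a) (by rwa [F.range_incl]) _ ?_
  rw [extIdx_incl]
  rcases Nat.eq_zero_or_pos (α a) with h0 | h0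
  -- With exponent zero at this vertex, `Ψ` reduces to the plain differential there, which the
  -- covering condition places among the factors.
  · right
    obtain ⟨l, hl⟩ := (h a).resolve_left (by omega)
    exact ⟨l, by simp [hl, Psi, extIdx_incl, h0]⟩
  · exact Or.inl h0

theorem extLin_injOn (T : Affine.Simplex ℝ P n) (F : Subsimplex n) {r : ℕ} (hr : 0 < r) (k : ℕ) :
    Set.InjOn (extLin 𝕂 T F hr k) (polySpace₀ 𝕂 (subsimplex T F) r k) :=
  Set.LeftInvOn.injOn (f₁' := pullback 𝕂 (subsimplex T F) T F.incl k) fun _ hω =>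
    trace_extLin_self 𝕂 T F hr hω

/-- Taking the trace on `F` of a vanishing sum leaves only the `F` component: proper faces of `F`
drop out by induction on the number of vertices, all other subsimplices by `trace_extLin_eq_zero`.
-/
theorem iSupIndep_map_extLin (T : Affine.Simplex ℝ P n) {r : ℕ} (hr : 0 < r) (k : ℕ) :
    iSupIndep fun F => (polySpace₀ 𝕂 (subsimplex T F) r k).map (extLin 𝕂 T F hr k) := by
  rw [iSupIndep_iff_finsetSum_eq_zero_imp_eq_zero]
  intro s v hv hsum F hF
  induction hN : #F.1 using Nat.strong_induction_on generalizing F with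
  | _ N ih =>
  obtain ⟨ω, hω, hωF⟩ := hv F hF
  have h := congrArg (pullback 𝕂 (subsimplex T F) T F.incl k) hsum
  rw [map_sum, map_zero, Finset.sum_eq_single_of_mem F hF, ← hωF, trace_extLin_self 𝕂 T F hr hω] at h
  · rw [← hωF, h, map_zero]
  · intro G hG hGF
    by_cases hle : G.1 ⊆ F.1
    · have hlt : #G.1 < N := hN ▸ Finset.card_lt_card
        (hle.ssubset_of_ne fun h => hGF (Subtype.ext h))
      rw [ih _ hlt G hG rfl, map_zero]
    · obtain ⟨η, hη, hηG⟩ := hv G hG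
      rw [← hηG, trace_extLin_eq_zero 𝕂 T hle hr hη]

end Extension

/-! ### Simplicial symmetries and their action on extensions -/

section Symmetry

variable (𝕂 : Type*) [RCLike 𝕂]
variable {V P : Type*} [AddCommGroup V] [Module ℝ V] [AddTorsor V P] {n : ℕ}

theorem Subsimplex.move_move_symm (π : Equiv.Perm (Fin (n + 1))) (F : Subsimplex n) :
    (F.move π.symm).move π = F := by
  apply Subtype.ext
  ext i
  simp [Subsimplex.move, Finset.mem_map_equiv]

theorem Subsimplex.moveIdx_bijective (π : Equiv.Perm (Fin (n + 1))) (F : Subsimplex n) :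
    (F.moveIdx π).Bijective := by
  have hinj : (F.moveIdx π).Injective := fun a b h => by
    have h2 := congrArg (F.move π).incl h
    rw [incl_moveIdx, incl_moveIdx] at h2
    exact F.incl.injective (π.symm.injective h2)
  refine (Fintype.bijective_iff_injective_and_card _).2 ⟨hinj, ?_⟩
  simp only [Fintype.card_fin, ← Subsimplex.card_eq]
  exact (Finset.card_map _).symm

/-- The subtracted sum runs over all vertices of the subsimplex, and the weight depends only on the
exponent at `i` and the total degree; both are compatible with relabelling. -/
theorem Psi_comp_simplexMap_perm (T : Affine.Simplex ℝ P n) (π : Equiv.Perm (Fin (n + 1)))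
    (F : Subsimplex n) (α : Fin (n + 1) → ℕ) (i : Fin (n + 1)) :
    (Psi T (F.move π) α (π.symm i)).comp (simplexMap T T π.symm).linear
      = Psi T F (α ∘ π.symm) i := by
  have h : ∑ j ∈ (F.move π).1, dbary T j = ∑ j ∈ F.1, dbary T (π.symm j) :=
    Finset.sum_map _ _ _
  rw [Psi, LinearMap.sub_comp, LinearMap.smul_comp, h, sum_comp_linearMap]
  simp only [dbary_comp_simplexMap T T π.symm.injective, Psi, Function.comp]
  rw [Equiv.sum_comp π.symm α]

theorem symmPullback_polyForm (T : Affine.Simplex ℝ P n) {k : ℕ} (π : Equiv.Perm (Fin (n + 1)))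
    (α : Fin (n + 1) → ℕ) (τ : Fin k → Fin (n + 1)) :
    symmPullback 𝕂 T k π (polyForm 𝕂 T α (fun j => dbary T (τ j)))
      = polyForm 𝕂 T (α ∘ π.symm) (fun j => dbary T (π (τ j))) := by
  rw [symmPullback, pullback_polyForm 𝕂 T T π.symm.injective _ fun j hj =>
    (hj (π.symm.surjective j)).elim]
  congr 1
  funext j
  rw [← dbary_comp_simplexMap T T π.symm.injective (π (τ j)), Equiv.symm_apply_apply]

/-- Provides the left inverse from which injectivity of `S_π^*` follows. -/
theorem symmPullback_symm_symmPullback (T : Affine.Simplex ℝ P n) {r k : ℕ}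
    (π : Equiv.Perm (Fin (n + 1))) {ω : Form 𝕂 T k} (hω : ω ∈ polySpace 𝕂 T r k) :
    symmPullback 𝕂 T k π.symm (symmPullback 𝕂 T k π ω) = ω := by
  refine LinearMap.eqOn_span
    (f := (symmPullback 𝕂 T k π.symm).comp (symmPullback 𝕂 T k π)) (g := LinearMap.id) ?_ hω
  rintro _ ⟨α, σ, -, rfl⟩
  rw [LinearMap.comp_apply, symmPullback_polyForm, symmPullback_polyForm, LinearMap.id_apply]
  simp [Function.comp_assoc]

theorem subPullback_polyForm (T : Affine.Simplex ℝ P n) {k : ℕ} (π : Equiv.Perm (Fin (n + 1)))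
    (F : Subsimplex n) (α : Fin ((F.move π).dim + 1) → ℕ) (τ : Fin k → Fin (F.dim + 1)) :
    subPullback 𝕂 T k π F (polyForm 𝕂 (subsimplex T (F.move π)) α
        (fun j => dbary (subsimplex T (F.move π)) (F.moveIdx π (τ j))))
      = polyForm 𝕂 (subsimplex T F) (α ∘ F.moveIdx π) (fun j => dbary (subsimplex T F) (τ j)) := by
  have hb := F.moveIdx_bijective π
  rw [subPullback, pullback_polyForm 𝕂 _ _ hb.1 _ fun j hj => (hj (hb.2 j)).elim]
  simp only [dbary_comp_simplexMap _ _ hb.1]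

/-- The extension operators commute with the simplicial symmetries. -/
theorem symmPullback_extLin (T : Affine.Simplex ℝ P n) {r : ℕ} (hr : 0 < r) {k : ℕ}
    (π : Equiv.Perm (Fin (n + 1))) (F : Subsimplex n) {ω : Form 𝕂 (subsimplex T (F.move π)) k}
    (hω : ω ∈ polySpace₀ 𝕂 (subsimplex T (F.move π)) r k) :
    symmPullback 𝕂 T k π (extLin 𝕂 T (F.move π) hr k ω)
      = extLin 𝕂 T F hr k (subPullback 𝕂 T k π F ω) := by
  refine LinearMap.eqOn_span
    (f := (symmPullback 𝕂 T k π).comp (extLin 𝕂 T (F.move π) hr k))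
    (g := (extLin 𝕂 T F hr k).comp (subPullback 𝕂 T k π F)) ?_ hω
  rintro _ ⟨α, σ, hα, -, rfl⟩
  have hb := F.moveIdx_bijective π
  -- The transported tuple `τ` need not be increasing; this is where `extLin_polyForm` is needed for
  -- arbitrary tuples.
  choose τ hτ using fun j => hb.2 (σ j)
  have hα' : ∑ i, (α ∘ F.moveIdx π) i = r := (hb.sum_comp α).trans hα
  have hidx : extIdx (F.move π) α ∘ π.symm = extIdx F (α ∘ F.moveIdx π) := by
    refine (eq_extIdx_iff F _ _).2 ⟨fun a => ?_, fun i hi => extIdx_of_notMem _ _ fun h => hi ?_⟩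
    · rw [Function.comp_apply, ← Subsimplex.incl_moveIdx, extIdx_incl]
      rfl
    · simpa [Subsimplex.move] using h
  rw [LinearMap.comp_apply, LinearMap.comp_apply, extLin_polyForm 𝕂 T _ hr hα]
  simp only [← hτ]
  rw [subPullback_polyForm, extLin_polyForm 𝕂 T F hr hα', symmPullback,
    pullback_polyForm 𝕂 T T π.symm.injective _ fun j hj => (hj (π.symm.surjective j)).elim, hidx]
  simp only [Subsimplex.incl_moveIdx, Psi_comp_simplexMap_perm, hidx]

end Symmetry

/-! ### From multiples of members to a permutation -/

section Invariance

variable {𝕂 : Type*} [RCLike 𝕂] {W : Type*} [AddCommGroup W] [Module 𝕂 W]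

/-- Operators that are injective on the span of a finite linearly independent set and take its
members to nonzero multiples of members leave it invariant. -/
theorem isInvariantSet_of_exists_smul {G : Type*} {ρ : G → W →ₗ[𝕂] W} {B : Set W} (hfin : B.Finite)
    (hind : LinearIndepOn 𝕂 id B) (hinj : ∀ g, Set.InjOn (ρ g) (Submodule.span 𝕂 B))
    (h : ∀ g, ∀ b ∈ B, ∃ b' ∈ B, ∃ χ : 𝕂, χ ≠ 0 ∧ ρ g b = χ • b') : IsInvariantSet ρ B := by
  refine ⟨hfin, fun g => ?_⟩
  have : Finite B := hfin
  choose τ hτ χ hχ heq using h g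
  let t : B → B := fun b => ⟨τ b.1 b.2, hτ b.1 b.2⟩
  have ht : t.Injective := by
    intro a b hab
    have hab' : τ a.1 a.2 = τ b.1 b.2 := congrArg Subtype.val hab
    -- If `a` and `b` land on multiples of the same member, cross-multiplying by the scalars
    -- equalises the images; injectivity then gives a nontrivial relation between `a` and `b`.
    have h1 : ρ g (χ b.1 b.2 • a.1) = ρ g (χ a.1 a.2 • b.1) := by
      rw [map_smul, map_smul, heq a.1 a.2, heq b.1 b.2, hab', smul_smul, smul_smul, mul_comm]
    have h2 := hinj g (Submodule.smul_mem _ _ (Submodule.subset_span a.2))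
      (Submodule.smul_mem _ _ (Submodule.subset_span b.2)) h1
    by_contra hne
    have hp := (LinearIndepOn.pair_iff id fun h => hne (Subtype.ext h)).1
      (hind.mono (Set.pair_subset a.2 b.2)) (χ b.1 b.2) (-χ a.1 a.2)
      (by rw [id, id, h2, neg_smul, add_neg_cancel])
    exact hχ b.1 b.2 hp.1
  exact ⟨Equiv.ofBijective t (Finite.injective_iff_bijective.1 ht), fun b => χ b.1 b.2,
    fun b => hχ b.1 b.2, fun b => heq b.1 b.2⟩

end Invariance

end SimplexForms

end

/-! ### The basis of the full space and its invariance -/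

open SimplexForms
theorem mainTheorem7 {𝕂 : Type*} [RCLike 𝕂] {V P : Type*} [AddCommGroup V] [Module ℝ V]
    [AddTorsor V P] {n : ℕ} (T : Affine.Simplex ℝ P n) (r k : ℕ) (hr : 0 < r)
    (Q : ∀ F : Subsimplex n, Set (Form 𝕂 (subsimplex T F) k))
    (hbasis : ∀ F, IsBasisOf (Q F) (polySpace₀ 𝕂 (subsimplex T F) r k))
    (hinv : ∀ F, IsInvariantSet (symmPullback 𝕂 (subsimplex T F) k) (Q F))
    (hcompat : ∀ (π : Equiv.Perm (Fin (n + 1))) (F : Subsimplex n),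
      EqUpToUnits 𝕂 (subPullback 𝕂 T k π F '' Q (F.move π)) (Q F)) :
    IsBasisOf (⋃ F : Subsimplex n, extOp 𝕂 T F hr k '' (Subtype.val ⁻¹' Q F)) (polySpace 𝕂 T r k) ∧
      IsInvariantSet (symmPullback 𝕂 T k)
        (⋃ F : Subsimplex n, extOp 𝕂 T F hr k '' (Subtype.val ⁻¹' Q F)) := by
  have hQ : ∀ F, Q F ⊆ polySpace₀ 𝕂 (subsimplex T F) r k := fun F => by
    rw [← (hbasis F).2.2]
    exact Submodule.subset_span
  -- Each `Q F` lies in the domain of `extOp`, so passing to the preimage in the subtype loses no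
  -- member.
  have himage : ∀ F, extOp 𝕂 T F hr k '' (Subtype.val ⁻¹' Q F) = extLin 𝕂 T F hr k '' Q F := by
    intro F
    ext η
    constructor
    · rintro ⟨ω, hω, rfl⟩
      exact ⟨ω, hω, (extOp_eq_extLin 𝕂 T F hr k ω).symm⟩
    · rintro ⟨ω, hω, rfl⟩
      exact ⟨⟨ω, hQ F hω⟩, hω, extOp_eq_extLin 𝕂 T F hr k _⟩
  simp only [himage]
  have hspan : ∀ F, Submodule.span 𝕂 (extLin 𝕂 T F hr k '' Q F)
      = (polySpace₀ 𝕂 (subsimplex T F) r k).map (extLin 𝕂 T F hr k) := fun F => by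
    rw [Submodule.span_image, (hbasis F).2.2]
  have hB : IsBasisOf (⋃ F, extLin 𝕂 T F hr k '' Q F) (polySpace 𝕂 T r k) := by
    refine ⟨Set.finite_iUnion fun F => (hbasis F).1.image _, ?_, ?_⟩
    · refine linearIndepOn_id_iUnion_finite (fun F => ?_) fun F t _ hF => ?_
      · refine (hbasis F).2.1.id_imageₛ ?_
        rw [(hbasis F).2.2]
        exact extLin_injOn 𝕂 T F hr k
      · simp only [hspan]
        exact (iSupIndep_map_extLin 𝕂 T hr k F).mono_right
          (iSup₂_le fun G hG => le_iSup₂_of_le G (by rintro rfl; exact hF hG) le_rfl)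
    · rw [Submodule.span_iUnion]
      simp only [hspan]
      exact iSup_map_extLin 𝕂 T hr k
  refine ⟨hB, isInvariantSet_of_exists_smul hB.1 hB.2.1 (fun π => ?_) fun π b hb => ?_⟩
  · rw [hB.2.2]
    exact Set.LeftInvOn.injOn (f₁' := symmPullback 𝕂 T k π.symm) fun _ hω =>
      symmPullback_symm_symmPullback 𝕂 T π hω
  · obtain ⟨G, hb⟩ := Set.mem_iUnion.1 hb
    -- Every subsimplex is `S_π F` for some `F`, so the commutation rule applies to any member of
    -- the union.
    obtain ⟨F, rfl⟩ : ∃ F : Subsimplex n, F.move π = G := ⟨_, G.move_move_symm π⟩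
    obtain ⟨ω, hω, rfl⟩ := hb
    -- Compatibility scales the pulled-back form by `χ` into `Q F`; hence the inverse scalar appears
    -- below.
    obtain ⟨χ, hχ, hmem⟩ := (hcompat π F).1 _ ⟨ω, hω, rfl⟩
    refine ⟨_, Set.mem_iUnion.2 ⟨F, Set.mem_image_of_mem _ hmem⟩, χ⁻¹, inv_ne_zero hχ, ?_⟩
    rw [symmPullback_extLin 𝕂 T hr π F (hQ _ hω), map_smul, inv_smul_smul₀ hχ]
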